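/- Let $\mathbb H$ be the quaternions, $\mathbb S=\{I\in\mathbb H: I^2=-1\}$ and $\mathbb C_I=\mathbb R+\mathbb R I$ for $I\in\mathbb S$. Let $D\subseteq\mathbb C$ be open with $\overline D=D$ and let $\Omega_D=\{\alpha+I\beta: \alpha+i\beta\in D,\ I\in\mathbb S\}$. A stem function is a map $F=F_0+\sqrt{-1}\,F_1:D\to\mathbb H\otimes\mathbb C$ ($F_0,F_1$ being $\mathbb H$-valued) with $F(\bar z)=\overline{F(z)}$, where $\overline{x+\sqrt{-1}\,y}=x-\sqrt{-1}\,y$; it induces the slice function $f(\alpha+I\beta)=F_0(\alpha+i\beta)+I\,F_1(\alpha+i\beta)$ on $\Omega_D$. A function $f:\Omega_D\to\mathbb H$ is slice regular if it is induced by a holomorphic stem function; a slice function is slice preserving if $F_0,F_1$ are real valued, and, for $J\in\mathbb S$, it is $\mathbb C_J$-preserving if $F_0,F_1$ are $\mathbb C_J$-valued. For $q_0\in\Omega_D\setminus\mathbb R$ put $\Delta_{q_0}(x)=x^2-2\,\mathrm{Re}(q_0)\,x+|q_0|^2$. The spherical coefficients $(s_n(q_0))_{n\ge 0}\subset\mathbb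 H$ of a slice regular $f$ at $q_0$ are the coefficients in the spherical expansion $$f(x)=\sum_{n\ge 0}\Delta_{q_0}(x)^n\,[\,s_{2n}(q_0)+(x-q_0)\,s_{2n+1}(q_0)\,],$$ valid on some Cassini ball $\{x\in\mathbb H: |\Delta_{q_0}(x)|<R^2\}\subseteq\Omega_D$ with $R>0$. Let $f:\Omega_D\to\mathbb H$ be slice regular. Then, at every $q_0\in\Omega_D\setminus\mathbb R$, the spherical coefficients exist and are unique, and the following hold. 1. $f$ is slice preserving if and only if, for every $q_0\in\Omega_D\setminus\mathbb R$ and every $k\in\mathbb N$, $s_{2k+1}(q_0)\in\mathbb R$ and, for $I\in\mathbb S$ with $q_0\in\mathbb C_I$, $s_{2k}(q_0)\in\mathbb C_I$. 2. Let $J\in\mathbb S$. Then $f$ is $\mathbb C_J$-preserving if and only if, for every $q_0\in\Omega_D\setminus\mathbb R$ and every $k\in\mathbb N$, $s_{2k+1}(q_0)\in\mathbb C_J$ and, if $q_0\in\mathbb C_J$, $s_{2k}(q_0)\in\mathbb C_J$. If moreover $\Omega_D$ is connected, then for any single fixed $q_0\in(\Omega_D\cap\mathbb C_J)\setminus\mathbb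 R$, $f$ is $\mathbb C_J$-preserving if and only if $s_n(q_0)\in\mathbb C_J$ for all $n\in\mathbb N$. -/

import Mathlib

open scoped Quaternion

namespace SliceRegular

/-- The sphere of imaginary units of the quaternions. -/
def imagUnits : Set ℍ[ℝ] := {I | I ^ 2 = -1}

/-- The complex plane `ℂ_I = {α + β I | α β : ℝ}` spanned by `1` and `I`. -/
def slicePlane (I : ℍ[ℝ]) : Set ℍ[ℝ] := {q | ∃ α β : ℝ, q = (α : ℍ[ℝ]) + (β : ℍ[ℝ]) * I}

/-- The real line inside the quaternions. -/
def realLine : Set ℍ[ℝ] := Set.range (fun r : ℝ => (r : ℍ[ℝ]))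

/-- The circularization `Ω_D` of a set `D` of complex numbers. -/
def circularization (D : Set ℂ) : Set ℍ[ℝ] :=
  {q | ∃ α β : ℝ, ∃ I ∈ imagUnits, (⟨α, β⟩ : ℂ) ∈ D ∧ q = (α : ℍ[ℝ]) + I * (β : ℍ[ℝ])}

/-- Multiplication by `√-1` on `ℍ ⊗ ℂ`, whose element `x + √-1 y` is written as the pair
`(x, y)`. -/
def mulSqrtNegOne (w : ℍ[ℝ] × ℍ[ℝ]) : ℍ[ℝ] × ℍ[ℝ] := (-w.2, w.1)

/-- `F = F₀ + √-1 F₁ : D → ℍ ⊗ ℂ` is a stem function: `F (conj z) = conj (F z)`, where the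
conjugate of `x + √-1 y` is `x - √-1 y`. -/
def IsStemFunction (D : Set ℂ) (F : ℂ → ℍ[ℝ] × ℍ[ℝ]) : Prop :=
  ∀ z ∈ D, F (starRingEnd ℂ z) = ((F z).1, -(F z).2)

/-- `F` induces the (left) slice function `f` on `Ω_D`:
`f (α + I β) = F₀ (α + i β) + I F₁ (α + i β)`. -/
def Induces (D : Set ℂ) (F : ℂ → ℍ[ℝ] × ℍ[ℝ]) (f : ℍ[ℝ] → ℍ[ℝ]) : Prop :=
  ∀ α β : ℝ, (⟨α, β⟩ : ℂ) ∈ D → ∀ I ∈ imagUnits,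
    f ((α : ℍ[ℝ]) + I * (β : ℍ[ℝ])) = (F ⟨α, β⟩).1 + I * (F ⟨α, β⟩).2

/-- `F : D → ℍ ⊗ ℂ` is holomorphic for the complex structure of `ℍ ⊗ ℂ`: at every point of `D`
its real differential exists and is complex linear. -/
def IsHolomorphic (D : Set ℂ) (F : ℂ → ℍ[ℝ] × ℍ[ℝ]) : Prop :=
  ∀ z ∈ D, ∃ L : ℂ →L[ℝ] ℍ[ℝ] × ℍ[ℝ],
    HasFDerivAt F L z ∧ ∀ v : ℂ, L (Complex.I * v) = mulSqrtNegOne (L v)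

/-- `f` is slice regular on `Ω_D`: it is induced by a holomorphic stem function. -/
def IsSliceRegular (D : Set ℂ) (f : ℍ[ℝ] → ℍ[ℝ]) : Prop :=
  ∃ F : ℂ → ℍ[ℝ] × ℍ[ℝ], IsStemFunction D F ∧ IsHolomorphic D F ∧ Induces D F f

/-- `f` is slice preserving on `Ω_D`: it is induced by a stem function with real components. -/
def IsSlicePreserving (D : Set ℂ) (f : ℍ[ℝ] → ℍ[ℝ]) : Prop :=
  ∃ F : ℂ → ℍ[ℝ] × ℍ[ℝ], IsStemFunction D F ∧ Induces D F f ∧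
    ∀ z ∈ D, (F z).1 ∈ realLine ∧ (F z).2 ∈ realLine

/-- `f` is `ℂ_J`-preserving on `Ω_D`: it is induced by a stem function with components
in `ℂ_J`. -/
def IsOneSlicePreserving (D : Set ℂ) (J : ℍ[ℝ]) (f : ℍ[ℝ] → ℍ[ℝ]) : Prop :=
  ∃ F : ℂ → ℍ[ℝ] × ℍ[ℝ], IsStemFunction D F ∧ Induces D F f ∧
    ∀ z ∈ D, (F z).1 ∈ slicePlane J ∧ (F z).2 ∈ slicePlane J

/-- The characteristic polynomial
`Δ_{q₀}(x) = x² - x (q₀ + q₀ᶜ) + q₀ q₀ᶜ = x² - 2 Re(q₀) x + |q₀|²`. -/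
noncomputable def charPoly (q₀ x : ℍ[ℝ]) : ℍ[ℝ] := x ^ 2 - x * (q₀ + star q₀) + q₀ * star q₀

/-- The Cassini ball `U(q₀, R)`. -/
def cassiniBall (q₀ : ℍ[ℝ]) (R : ℝ) : Set ℍ[ℝ] := {x | ‖charPoly q₀ x‖ < R ^ 2}

/-- `f(x) = ∑ₙ Δ_{q₀}(x)ⁿ [s₂ₙ + (x - q₀) s₂ₙ₊₁]` on some Cassini ball contained in `Ω_D`. -/
def HasSphericalExpansion (D : Set ℂ) (f : ℍ[ℝ] → ℍ[ℝ]) (q₀ : ℍ[ℝ]) (s : ℕ → ℍ[ℝ]) : Prop :=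
  ∃ R : ℝ, 0 < R ∧ cassiniBall q₀ R ⊆ circularization D ∧
    ∀ x ∈ cassiniBall q₀ R,
      HasSum (fun n : ℕ => charPoly q₀ x ^ n * (s (2 * n) + (x - q₀) * s (2 * n + 1))) (f x)

open Classical in
/-- The spherical coefficients `s_n(q₀)` of `f` at `q₀` (the zero sequence if there is no
spherical expansion at `q₀`). -/
noncomputable def sphericalCoeff (D : Set ℂ) (f : ℍ[ℝ] → ℍ[ℝ]) (q₀ : ℍ[ℝ]) : ℕ → ℍ[ℝ] :=
  if h : ∃ s, HasSphericalExpansion D f q₀ s then h.choose else 0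

end SliceRegular

open SliceRegular

/-!
Everything is transported to the stem function `F`. Restricted to a slice `ℂ_I`, the polynomial
`Δ_{q₀}` is the complex polynomial `Δ(z) = (z - z₀) (z - conj z₀)`, where `z₀` is the point of the
upper half-plane representing the sphere of `q₀`. Hence a spherical expansion of `f` at `q₀` is the
same as an expansion `F z = ∑ₙ Δ(z)ⁿ (aₙ + (z - Re z₀) bₙ)`, with `aₙ = s₂ₙ - Im(q₀) s₂ₙ₊₁` and
`bₙ = s₂ₙ₊₁`. It exists because a holomorphic function of `v = z - Re z₀` splits as
`e(v²) + v o(v²)` and `Δ(z) = v² + (Im z₀)²`.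

On the vertical line `Re z = Re z₀` the polynomial `Δ` is real and `v` is imaginary, so there the
two components of `F` are real power series in `Δ` with coefficients `aₙ` and `bₙ`, up to a
factor. So, for a closed real subspace `V`, all `aₙ` and `bₙ` lie in `V` if and only if both
components of `F` take values in `V` near `z₀`. Uniqueness is the case `V = 0`, and the
characterizations are the case `V = ℂ_J`, together with `ℝ = ⋂_J ℂ_J`; passing from a
neighbourhood of `z₀` to all of `D` is the identity theorem on the part of `D` in the closed upper
half-plane.
-/

namespace SliceRegular

open Filter Topology Metric

theorem forall_coeff_mem_of_eventually_hasSum {𝕜 E : Type*} [NontriviallyNormedField 𝕜]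
    [NormedAddCommGroup E] [NormedSpace 𝕜 E] {V : Submodule 𝕜 E} (hV : IsClosed (V : Set E))
    {c : ℕ → E} (hc : ∀ᶠ t : 𝕜 in 𝓝 0, ∃ p ∈ V, HasSum (fun n => t ^ n • c n) p) (n : ℕ) :
    c n ∈ V := by
  let p : FormalMultilinearSeries 𝕜 𝕜 (E ⧸ V) :=
    fun n => ContinuousMultilinearMap.mkPiRing 𝕜 (Fin n) (V.mkQL (c n))
  have hp (n : ℕ) : p.coeff n = V.mkQL (c n) := by simp [p, FormalMultilinearSeries.coeff]
  have hzero : HasFPowerSeriesAt (0 : 𝕜 → E ⧸ V) p 0 := by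
    rw [hasFPowerSeriesAt_iff]
    filter_upwards [hc] with t ⟨p, hpV, hsum⟩
    have hmk : V.mkQL p = 0 := (Submodule.Quotient.mk_eq_zero V).2 hpV
    simpa only [hp, map_smul, hmk, Pi.zero_apply] using V.mkQL.hasSum hsum
  have hcoeff : V.mkQL (c n) = 0 := by
    rw [← hp, hzero.eq_zero]
    rfl
  exact (Submodule.Quotient.mk_eq_zero V).1 hcoeff

theorem exists_differentiableOn_sq_eq_sub (c : ℂ) :
    ∃ u : ℂ → ℂ, DifferentiableOn ℂ u (ball 0 ‖c‖) ∧ ∀ w ∈ ball 0 ‖c‖, u w ^ 2 = w - c := by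
  obtain ⟨d, hd⟩ : ∃ d : ℂ, d ^ 2 = -c := IsAlgClosed.exists_pow_nat_eq _ two_pos
  have hslit {w : ℂ} (hw : w ∈ ball 0 ‖c‖) : 1 - w / c ∈ Complex.slitPlane := by
    have hc : 0 < ‖c‖ := pos_of_mem_ball hw
    have hlt : ‖-(w / c)‖ < 1 := by
      rw [norm_neg, norm_div, div_lt_one hc]
      exact mem_ball_zero_iff.1 hw
    exact Complex.mem_slitPlane_of_norm_lt_one hlt
  refine ⟨fun w => d * (1 - w / c) ^ (2⁻¹ : ℂ), fun w hw => ?_, fun w hw => ?_⟩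
  · have hlin : DifferentiableAt ℂ (fun w => 1 - w / c) w := by fun_prop
    exact ((hlin.cpow_const (hslit hw)).const_mul d).differentiableWithinAt
  · have hc : c ≠ 0 := norm_pos_iff.1 (pos_of_mem_ball hw)
    rw [mul_pow, hd, Complex.cpow_ofNat_inv_pow]
    field_simp
    ring

section EvenOdd

variable {E : Type*} [NormedAddCommGroup E] [NormedSpace ℂ E] {c : ℂ} {r : ℝ} {h : ℂ → E}

theorem exists_even_odd_decomposition (hr : r ≤ ‖c‖)
    (hh : DifferentiableOn ℂ h {v | ‖v ^ 2 + c‖ < r}) :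
    ∃ e o : ℂ → E, DifferentiableOn ℂ e (ball 0 r) ∧ DifferentiableOn ℂ o (ball 0 r) ∧
      ∀ v, ‖v ^ 2 + c‖ < r → h v = e (v ^ 2 + c) + v • o (v ^ 2 + c) := by
  obtain ⟨u, hu, husq⟩ := exists_differentiableOn_sq_eq_sub c
  replace hu := hu.mono (ball_subset_ball hr)
  replace husq : ∀ w ∈ ball 0 r, u w ^ 2 = w - c := fun w hw => husq w (ball_subset_ball hr hw)
  have hune : ∀ w ∈ ball 0 r, u w ≠ 0 := by
    intro w hw h0
    have hwc : w = c := by simpa [h0, sub_eq_zero, eq_comm] using husq w hw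
    exact (mem_ball_zero_iff.1 hw).not_ge (hwc ▸ hr)
  have hpos : DifferentiableOn ℂ (fun w => h (u w)) (ball 0 r) :=
    hh.comp hu fun w hw => by simpa [husq w hw] using hw
  have hneg : DifferentiableOn ℂ (fun w => h (-u w)) (ball 0 r) :=
    hh.comp hu.neg fun w hw => by simpa [husq w hw] using hw
  refine ⟨fun w => (2⁻¹ : ℂ) • (h (u w) + h (-u w)), fun w => (2 * u w)⁻¹ • (h (u w) - h (-u w)),
    (hpos.add hneg).const_smul _,
    ((hu.const_mul 2).inv fun w hw => mul_ne_zero two_ne_zero (hune w hw)).smul (hpos.sub hneg),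
    fun v hv => ?_⟩
  have hw : v ^ 2 + c ∈ ball 0 r := mem_ball_zero_iff.2 hv
  have hvsq : u (v ^ 2 + c) ^ 2 = v ^ 2 := by rw [husq _ hw, add_sub_cancel_right]
  have hne := hune _ hw
  change h v = (2⁻¹ : ℂ) • (h (u (v ^ 2 + c)) + h (-u (v ^ 2 + c))) +
    v • (2 * u (v ^ 2 + c))⁻¹ • (h (u (v ^ 2 + c)) - h (-u (v ^ 2 + c)))
  rcases sq_eq_sq_iff_eq_or_eq_neg.1 hvsq with huv | huv <;> rw [huv] at hne ⊢
  · have hscal : v * (2 * v)⁻¹ = 2⁻¹ := by field_simp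
    rw [smul_smul, hscal]
    module
  · have hscal : v * (2 * -v)⁻¹ = -2⁻¹ := by
      have hv0 : v ≠ 0 := neg_ne_zero.1 hne
      field_simp
    rw [smul_smul, hscal, neg_neg]
    module

theorem exists_hasSum_even_odd [CompleteSpace E] (hr : r ≤ ‖c‖)
    (hh : DifferentiableOn ℂ h {v | ‖v ^ 2 + c‖ < r}) :
    ∃ a b : ℕ → E, ∀ v, ‖v ^ 2 + c‖ < r →
      HasSum (fun n => (v ^ 2 + c) ^ n • (a n + v • b n)) (h v) := by
  obtain ⟨e, o, he, ho, hdec⟩ := exists_even_odd_decomposition hr hh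
  refine ⟨fun n => (n.factorial : ℂ)⁻¹ • iteratedDeriv n e 0,
    fun n => (n.factorial : ℂ)⁻¹ • iteratedDeriv n o 0, fun v hv => ?_⟩
  have hw : v ^ 2 + c ∈ ball 0 r := mem_ball_zero_iff.2 hv
  rw [hdec v hv]
  convert (Complex.hasSum_taylorSeries_on_ball he hw).add
    ((Complex.hasSum_taylorSeries_on_ball ho hw).const_smul v) using 2 with n
  rw [sub_zero]
  module

end EvenOdd

theorem exists_real_coeff_hasSum_even_odd {c r : ℝ} {h : ℂ → ℂ} (hr : r ≤ ‖c‖)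
    (hh : DifferentiableOn ℂ h {v | ‖v ^ 2 + c‖ < r})
    (hconj : ∀ v : ℂ, ‖v ^ 2 + c‖ < r → h (starRingEnd ℂ v) = starRingEnd ℂ (h v)) :
    ∃ a b : ℕ → ℝ, ∀ v : ℂ, ‖v ^ 2 + c‖ < r →
      HasSum (fun n => (v ^ 2 + c) ^ n * (a n + v * b n)) (h v) := by
  obtain ⟨a, b, hsum⟩ := exists_hasSum_even_odd (hr.trans_eq (Complex.norm_real c).symm) hh
  refine ⟨fun n => (a n).re, fun n => (b n).re, fun v hv => ?_⟩
  have hv' : ‖(starRingEnd ℂ v) ^ 2 + c‖ < r := by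
    rwa [← RCLike.norm_conj, map_add, map_pow, Complex.conj_conj, Complex.conj_ofReal]
  have hreflect := Complex.hasSum_conj'.2 (hsum _ hv')
  rw [hconj v hv, Complex.conj_conj] at hreflect
  have hmean := ((hsum v hv).add hreflect).const_smul (2⁻¹ : ℂ)
  rw [← two_mul, smul_eq_mul, inv_mul_cancel_left₀ two_ne_zero] at hmean
  have hterm (n : ℕ) : (v ^ 2 + c) ^ n * ((a n).re + v * (b n).re) =
      (2⁻¹ : ℂ) • ((v ^ 2 + c) ^ n • (a n + v • b n) +
        starRingEnd ℂ ((starRingEnd ℂ v ^ 2 + c) ^ n • (a n + starRingEnd ℂ v • b n))) := by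
    simp only [map_mul, map_pow, map_add, smul_eq_mul, Complex.conj_conj, Complex.conj_ofReal,
      Complex.re_eq_add_conj]
    ring
  simpa only [hterm] using hmean

section

variable {D : Set ℂ}

theorem star_eq_neg_of_mem_imagUnits {I : ℍ[ℝ]} (hI : I ∈ imagUnits) : star I = -I := by
  have hsq : I ^ 2 = -1 := hI
  have hnorm : ‖I‖ = 1 := by
    have h : ‖I‖ ^ 2 = 1 := by rw [← norm_pow, hsq, norm_neg, norm_one]
    exact (pow_eq_one_iff_of_nonneg (norm_nonneg I) two_ne_zero).1 h
  rw [Quaternion.star_eq_neg, ← Quaternion.sq_eq_neg_normSq, hsq,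
    Quaternion.normSq_eq_norm_mul_self, hnorm, one_mul, Quaternion.coe_one]

theorem neg_mem_imagUnits {I : ℍ[ℝ]} (hI : I ∈ imagUnits) : -I ∈ imagUnits := by
  simpa [imagUnits] using hI

theorem imagUnits_mul_self (I : imagUnits) : (I * I : ℍ[ℝ]) = -1 := by
  rw [← sq]
  exact I.2

theorem norm_inv_smul_im_mem_imagUnits {q : ℍ[ℝ]} (hq : q.im ≠ 0) :
    ‖q.im‖⁻¹ • q.im ∈ imagUnits := by
  have hnorm : ‖q.im‖ ≠ 0 := norm_ne_zero_iff.2 hq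
  change (‖q.im‖⁻¹ • q.im) ^ 2 = -1
  rw [smul_pow, Quaternion.im_sq, Quaternion.normSq_eq_norm_mul_self, smul_neg,
    Quaternion.smul_coe, ← sq, ← mul_pow, inv_mul_cancel₀ hnorm, one_pow, Quaternion.coe_one]

theorem mem_imagUnits_of_re_eq_zero {I : ℍ[ℝ]} (hre : I.re = 0)
    (him : I.imI ^ 2 + I.imJ ^ 2 + I.imK ^ 2 = 1) : I ∈ imagUnits := by
  have hnorm : Quaternion.normSq I = 1 := by simpa [Quaternion.normSq_def', hre] using him
  change I ^ 2 = -1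
  rw [Quaternion.sq_eq_neg_normSq.2 hre, hnorm, Quaternion.coe_one]

instance : Nonempty imagUnits :=
  ⟨⟨⟨0, 1, 0, 0⟩, mem_imagUnits_of_re_eq_zero rfl (by simp)⟩⟩

/-- The embedding `α + iβ ↦ α + Iβ` of `ℂ` onto the slice `ℂ_I`. -/
noncomputable def sliceEmb (I : imagUnits) : ℂ →ₐ[ℝ] ℍ[ℝ] :=
  Complex.lift ⟨I, imagUnits_mul_self I⟩

theorem sliceEmb_apply (I : imagUnits) (z : ℂ) :
    sliceEmb I z = (z.re : ℍ[ℝ]) + I * (z.im : ℍ[ℝ]) := by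
  rw [sliceEmb, Complex.lift_apply, Complex.liftAux_apply, Quaternion.mul_coe_eq_smul]
  rfl

theorem sliceEmb_ofReal (I : imagUnits) (r : ℝ) : sliceEmb I r = r :=
  (sliceEmb I).commutes r

theorem re_sliceEmb (I : imagUnits) (z : ℂ) : (sliceEmb I z).re = z.re := by
  have hI := Quaternion.star_eq_neg.1 (star_eq_neg_of_mem_imagUnits I.2)
  simp [sliceEmb_apply, Quaternion.mul_coe_eq_smul, hI]

theorem im_sliceEmb (I : imagUnits) (z : ℂ) :
    (sliceEmb I z).im = sliceEmb I (z.im * Complex.I) := by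
  have h : (sliceEmb I z).im = sliceEmb I z - z.re := by
    rw [← re_sliceEmb I z, Quaternion.sub_re_self]
  rw [h, ← sliceEmb_ofReal I, ← map_sub]
  congr 1
  apply Complex.ext <;> simp

theorem norm_sliceEmb (I : imagUnits) (z : ℂ) : ‖sliceEmb I z‖ = ‖z‖ := by
  have hstar : star (sliceEmb I z) = sliceEmb I (starRingEnd ℂ z) := by
    simp [sliceEmb_apply, star_eq_neg_of_mem_imagUnits I.2, Quaternion.mul_coe_eq_smul]
  have hsq : ‖sliceEmb I z‖ * ‖sliceEmb I z‖ = ‖z‖ * ‖z‖ := by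
    apply Quaternion.coe_injective
    rw [← Quaternion.normSq_eq_norm_mul_self, ← Quaternion.self_mul_star, hstar, ← map_mul,
      Complex.mul_conj', sq, ← Complex.ofReal_mul, sliceEmb_ofReal]
  exact (mul_self_inj (norm_nonneg _) (norm_nonneg _)).1 hsq

/-- The point `α + iβ` of the closed upper half-plane representing the sphere of all `α + Iβ`
through a given quaternion. -/
noncomputable def halfPlaneCoord (q : ℍ[ℝ]) : ℂ := ⟨q.re, ‖q.im‖⟩

theorem continuous_halfPlaneCoord : Continuous halfPlaneCoord :=
  Complex.equivRealProdCLM.symm.continuous.comp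
    (Quaternion.continuous_re.prodMk Quaternion.continuous_im.norm)

theorem exists_sliceEmb_halfPlaneCoord (q : ℍ[ℝ]) :
    ∃ I : imagUnits, sliceEmb I (halfPlaneCoord q) = q := by
  by_cases hq : q.im = 0
  · obtain ⟨I⟩ : Nonempty imagUnits := inferInstance
    refine ⟨I, ?_⟩
    rw [sliceEmb_apply, halfPlaneCoord, hq, norm_zero, Quaternion.coe_zero, mul_zero, ← hq,
      Quaternion.re_add_im]
  · refine ⟨⟨_, norm_inv_smul_im_mem_imagUnits hq⟩, ?_⟩
    rw [sliceEmb_apply, halfPlaneCoord, Quaternion.mul_coe_eq_smul,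
      smul_inv_smul₀ (norm_ne_zero_iff.2 hq), Quaternion.re_add_im]

theorem halfPlaneCoord_sliceEmb (I : imagUnits) (z : ℂ) :
    halfPlaneCoord (sliceEmb I z) = ⟨z.re, |z.im|⟩ := by
  rw [halfPlaneCoord, re_sliceEmb, im_sliceEmb, norm_sliceEmb, norm_mul, Complex.norm_I, mul_one,
    Complex.norm_real, Real.norm_eq_abs]

theorem halfPlaneCoord_sliceEmb_eq_or (I : imagUnits) (z : ℂ) :
    halfPlaneCoord (sliceEmb I z) = z ∨ halfPlaneCoord (sliceEmb I z) = starRingEnd ℂ z := by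
  rw [halfPlaneCoord_sliceEmb]
  exact (abs_choice z.im).imp (Complex.ext rfl) (Complex.ext rfl)

theorem halfPlaneCoord_sliceEmb_mem (hDs : ∀ z ∈ D, starRingEnd ℂ z ∈ D) (I : imagUnits) {z : ℂ} :
    halfPlaneCoord (sliceEmb I z) ∈ D ↔ z ∈ D := by
  rcases halfPlaneCoord_sliceEmb_eq_or I z with h | h
  · rw [h]
  · rw [h]
    exact ⟨fun hz => Complex.conj_conj z ▸ hDs _ hz, hDs z⟩

theorem mem_circularization_iff (hDs : ∀ z ∈ D, starRingEnd ℂ z ∈ D) {q : ℍ[ℝ]} :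
    q ∈ circularization D ↔ halfPlaneCoord q ∈ D := by
  constructor
  · rintro ⟨α, β, I, hI, hz, rfl⟩
    have hmem := (halfPlaneCoord_sliceEmb_mem hDs ⟨I, hI⟩).2 hz
    rwa [sliceEmb_apply] at hmem
  · intro hq
    obtain ⟨I, hI⟩ := exists_sliceEmb_halfPlaneCoord q
    exact ⟨_, _, I, I.2, hq, hI.symm.trans (sliceEmb_apply I _)⟩

theorem sliceEmb_mem_circularization (hDs : ∀ z ∈ D, starRingEnd ℂ z ∈ D) (I : imagUnits) {z : ℂ} :
    sliceEmb I z ∈ circularization D ↔ z ∈ D :=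
  (mem_circularization_iff hDs).trans (halfPlaneCoord_sliceEmb_mem hDs I)

theorem mem_realLine_iff_im_eq_zero {q : ℍ[ℝ]} : q ∈ realLine ↔ q.im = 0 := by
  constructor
  · rintro ⟨r, rfl⟩
    exact Quaternion.im_coe r
  · intro hq
    exact ⟨q.re, by simpa [hq] using Quaternion.re_add_im q⟩

theorem halfPlaneCoord_im_pos {q : ℍ[ℝ]} (hq : q ∉ realLine) : 0 < (halfPlaneCoord q).im :=
  norm_pos_iff.2 (mt mem_realLine_iff_im_eq_zero.2 hq)

/-- The polynomial `(z - z₀) (z - conj z₀)`, which `charPoly` restricts to on each slice. -/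
noncomputable def complexCharPoly (z₀ z : ℂ) : ℂ := (z - z₀) * (z - starRingEnd ℂ z₀)

theorem complexCharPoly_eq_sq_add_sq (z₀ z : ℂ) :
    complexCharPoly z₀ z = (z - z₀.re) ^ 2 + (z₀.im : ℂ) ^ 2 := by
  have hsum : z₀ + starRingEnd ℂ z₀ = 2 * z₀.re := by rw [Complex.add_conj]; push_cast; rfl
  have hprod : z₀ * starRingEnd ℂ z₀ = (z₀.re : ℂ) ^ 2 + (z₀.im : ℂ) ^ 2 := by
    rw [Complex.mul_conj, Complex.normSq_apply]; push_cast; ring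
  rw [complexCharPoly]
  linear_combination hprod - z * hsum

theorem complexCharPoly_self (z₀ : ℂ) : complexCharPoly z₀ z₀ = 0 := by simp [complexCharPoly]

theorem complexCharPoly_re_add_mul_I (z₀ : ℂ) (y : ℝ) :
    complexCharPoly z₀ (z₀.re + y * Complex.I) = (z₀.im ^ 2 - y ^ 2 : ℝ) := by
  rw [complexCharPoly_eq_sq_add_sq, add_sub_cancel_left, mul_pow, Complex.I_sq]
  push_cast
  ring

theorem continuous_complexCharPoly (z₀ : ℂ) : Continuous (complexCharPoly z₀) := by
  unfold complexCharPoly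
  fun_prop

theorem norm_halfPlaneCoord (q : ℍ[ℝ]) : ‖halfPlaneCoord q‖ = ‖q‖ := by
  obtain ⟨I, hI⟩ := exists_sliceEmb_halfPlaneCoord q
  rw [← norm_sliceEmb I, hI]

theorem charPoly_sliceEmb (q₀ : ℍ[ℝ]) (I : imagUnits) (z : ℂ) :
    charPoly q₀ (sliceEmb I z) = sliceEmb I (complexCharPoly (halfPlaneCoord q₀) z) := by
  set z₀ := halfPlaneCoord q₀ with hz₀
  have htrace : q₀ + star q₀ = sliceEmb I (z₀ + starRingEnd ℂ z₀) := by
    rw [Complex.add_conj, sliceEmb_ofReal, Quaternion.self_add_star', hz₀, halfPlaneCoord]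
  have hnorm : q₀ * star q₀ = sliceEmb I (z₀ * starRingEnd ℂ z₀) := by
    rw [Complex.mul_conj', hz₀, norm_halfPlaneCoord, ← Complex.ofReal_pow, sliceEmb_ofReal,
      Quaternion.self_mul_star, Quaternion.normSq_eq_norm_mul_self, sq]
  rw [charPoly, htrace, hnorm, ← map_pow, ← map_mul, ← map_sub, ← map_add, complexCharPoly]
  congr 1
  ring

theorem exists_complexCharPoly_ball_subset (hDo : IsOpen D) (hDs : ∀ z ∈ D, starRingEnd ℂ z ∈ D)
    {z₀ : ℂ} (hz₀ : z₀ ∈ D) {δ : ℝ} (hδ : 0 < δ) :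
    ∃ R, 0 < R ∧ R ≤ δ ∧ ∀ z, ‖complexCharPoly z₀ z‖ < R ^ 2 → z ∈ D := by
  obtain ⟨ε, hε, hball⟩ := Metric.isOpen_iff.1 hDo z₀ hz₀
  refine ⟨min ε δ, lt_min hε hδ, min_le_right _ _, fun z hz => ?_⟩
  have hmem : ∀ w, ‖w - z₀‖ < min ε δ → w ∈ D := fun w hw =>
    hball (mem_ball_iff_norm.2 (hw.trans_le (min_le_left _ _)))
  have hnear : ‖z - z₀‖ < min ε δ ∨ ‖z - starRingEnd ℂ z₀‖ < min ε δ := by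
    rw [complexCharPoly, norm_mul, sq] at hz
    by_contra! h
    exact hz.not_ge (mul_le_mul h.1 h.2 (lt_min hε hδ).le (norm_nonneg _))
  rcases hnear with h | h
  · exact hmem z h
  · rw [← RCLike.norm_conj, map_sub, Complex.conj_conj] at h
    exact Complex.conj_conj z ▸ hDs _ (hmem _ h)

end

section PureTensor

variable {E : Type*} [NormedAddCommGroup E] [NormedSpace ℝ E]

/-- The bilinear map `(q, w) ↦ q ⊗ w` into `E ⊗ ℂ`, whose element `x + √-1 y` is written as the
pair `(x, y)`. -/
noncomputable def pureTensor : E →ₗ[ℝ] ℂ →L[ℝ] E × E where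
  toFun q := (Complex.reCLM.smulRight q).prod (Complex.imCLM.smulRight q)
  map_add' p q := by ext <;> simp
  map_smul' r q := ContinuousLinearMap.ext fun _ => Prod.ext (smul_comm _ r q) (smul_comm _ r q)

theorem pureTensor_apply (q : E) (w : ℂ) : pureTensor q w = (w.re • q, w.im • q) := rfl

theorem pureTensor_mem_prod {V : Submodule ℝ E} {q : E} (hq : q ∈ V) (w : ℂ) :
    pureTensor q w ∈ V.prod V :=
  ⟨V.smul_mem _ hq, V.smul_mem _ hq⟩

/-- The complexification `x + √-1 y ↦ ℓ x + i ℓ y` of a real functional `ℓ`. -/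
noncomputable def complexComponent (ℓ : E →L[ℝ] ℝ) : E × E →L[ℝ] ℂ :=
  (Complex.equivRealProdCLM.symm : ℝ × ℝ →L[ℝ] ℂ).comp (ℓ.prodMap ℓ)

theorem complexComponent_apply (ℓ : E →L[ℝ] ℝ) (p : E × E) :
    complexComponent ℓ p = ⟨ℓ p.1, ℓ p.2⟩ := rfl

theorem sum_pureTensor_complexComponent {ι : Type*} [Fintype ι] [FiniteDimensional ℝ E]
    (β : Module.Basis ι ℝ E) (p : E × E) :
    ∑ j, pureTensor (β j) (complexComponent (LinearMap.toContinuousLinearMap (β.coord j)) p) =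
      p := by
  refine Prod.ext ?_ ?_
  · rw [Prod.fst_sum]
    exact β.sum_repr p.1
  · rw [Prod.snd_sum]
    exact β.sum_repr p.2

theorem mem_prod_iff_complexComponent [FiniteDimensional ℝ E] {V : Submodule ℝ E} {p : E × E} :
    p ∈ V.prod V ↔ ∀ ℓ : E →L[ℝ] ℝ, (∀ v ∈ V, ℓ v = 0) → complexComponent ℓ p = 0 := by
  constructor
  · rintro ⟨h₁, h₂⟩ ℓ hℓ
    exact Complex.ext (hℓ _ h₁) (hℓ _ h₂)
  · intro h
    have hmem {x : E} (hx : ∀ ℓ : E →L[ℝ] ℝ, (∀ v ∈ V, ℓ v = 0) → ℓ x = 0) : x ∈ V :=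
      (Subspace.forall_mem_dualAnnihilator_apply_eq_zero_iff V x).1 fun φ hφ =>
        hx (LinearMap.toContinuousLinearMap φ) ((Submodule.mem_dualAnnihilator φ).1 hφ)
    exact ⟨hmem fun ℓ hℓ => congrArg Complex.re (h ℓ hℓ),
      hmem fun ℓ hℓ => congrArg Complex.im (h ℓ hℓ)⟩

end PureTensor

/-- The spherical expansion of a stem function with values in `E ⊗ ℂ`:
`F z = ∑ₙ Δ(z)ⁿ (aₙ + (z - Re z₀) bₙ)` near `z₀` and its conjugate. The linear factor is centred
at `Re z₀`, and not at `z₀`, so that the coefficients lie in `E`. -/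
def HasStemExpansion {E : Type*} [NormedAddCommGroup E] [NormedSpace ℝ E] (D : Set ℂ)
    (F : ℂ → E × E) (z₀ : ℂ) (a b : ℕ → E) : Prop :=
  ∃ R : ℝ, 0 < R ∧ ∀ z, ‖complexCharPoly z₀ z‖ < R ^ 2 → z ∈ D ∧
    HasSum (fun n => pureTensor (a n) (complexCharPoly z₀ z ^ n) +
      pureTensor (b n) (complexCharPoly z₀ z ^ n * (z - z₀.re))) (F z)

section StemExpansion

variable {E : Type*} [NormedAddCommGroup E] [NormedSpace ℝ E] {D : Set ℂ} {F G : ℂ → E × E}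
  {z₀ : ℂ} {a a' b b' : ℕ → E} {V : Submodule ℝ E}

theorem eventually_norm_complexCharPoly_lt {w : ℂ} (hw : complexCharPoly z₀ w = 0) {R : ℝ}
    (hR : 0 < R) : ∀ᶠ z in 𝓝 w, ‖complexCharPoly z₀ z‖ < R ^ 2 := by
  have htends : Tendsto (fun z => ‖complexCharPoly z₀ z‖) (𝓝 w) (𝓝 0) := by
    simpa [hw] using (continuous_complexCharPoly z₀).norm.tendsto w
  exact htends.eventually_lt_const (pow_pos hR 2)

theorem HasStemExpansion.eventually_hasSum (h : HasStemExpansion D F z₀ a b) :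
    ∀ᶠ z in 𝓝 z₀, HasSum (fun n => pureTensor (a n) (complexCharPoly z₀ z ^ n) +
      pureTensor (b n) (complexCharPoly z₀ z ^ n * (z - z₀.re))) (F z) := by
  obtain ⟨R, hR, hsum⟩ := h
  filter_upwards [eventually_norm_complexCharPoly_lt (complexCharPoly_self z₀) hR] with z hz
    using (hsum z hz).2

theorem HasStemExpansion.eventually_mem (h : HasStemExpansion D F z₀ a b)
    (hV : IsClosed (V : Set E)) (hab : ∀ n, a n ∈ V ∧ b n ∈ V) :
    ∀ᶠ z in 𝓝 z₀, F z ∈ V.prod V := by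
  have hclosed : IsClosed (V.prod V : Set (E × E)) := hV.prod hV
  filter_upwards [h.eventually_hasSum] with z hz
  exact hclosed.mem_of_tendsto hz <| .of_forall fun t => sum_mem fun n _ =>
    add_mem (pureTensor_mem_prod (hab n).1 _) (pureTensor_mem_prod (hab n).2 _)

theorem HasStemExpansion.coeff_mem (h : HasStemExpansion D F z₀ a b) (him : 0 < z₀.im)
    (hV : IsClosed (V : Set E)) (hF : ∀ᶠ z in 𝓝 z₀, F z ∈ V.prod V) (n : ℕ) :
    a n ∈ V ∧ b n ∈ V := by
  -- On the vertical line through `z₀` the polynomial `Δ` is real and `z - Re z₀` is imaginary,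
  -- so the two components of `F` separate the coefficients `aₙ` and `bₙ`.
  let y (t : ℝ) : ℝ := √(z₀.im ^ 2 - t)
  let γ (t : ℝ) : ℂ := z₀.re + y t * Complex.I
  have hγ : Tendsto γ (𝓝 0) (𝓝 z₀) := by
    have hcont : Continuous γ := by fun_prop
    simpa [γ, y, Real.sqrt_sq him.le] using hcont.tendsto 0
  have hlt : ∀ᶠ t : ℝ in 𝓝 0, t < z₀.im ^ 2 := eventually_lt_nhds (pow_pos him 2)
  have hcomp : ∀ᶠ t : ℝ in 𝓝 0, F (γ t) ∈ V.prod V ∧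
      HasSum (fun n => (t ^ n • a n, t ^ n • y t • b n)) (F (γ t)) := by
    filter_upwards [hγ.eventually (hF.and h.eventually_hasSum), hlt] with t ⟨hmem, hsum⟩ ht
    have hchar : complexCharPoly z₀ (γ t) = t := by
      rw [complexCharPoly_re_add_mul_I, Real.sq_sqrt (sub_pos.2 ht).le, sub_sub_cancel]
    refine ⟨hmem, ?_⟩
    simpa [hchar, γ, pureTensor_apply, ← Complex.ofReal_pow, smul_smul] using hsum
  refine ⟨forall_coeff_mem_of_eventually_hasSum hV ?_ n,
    forall_coeff_mem_of_eventually_hasSum hV ?_ n⟩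
  · filter_upwards [hcomp] with t ⟨hmem, hsum⟩
    exact ⟨_, hmem.1, (ContinuousLinearMap.fst ℝ E E).hasSum hsum⟩
  · filter_upwards [hcomp, hlt] with t ⟨hmem, hsum⟩ ht
    have hne : y t ≠ 0 := (Real.sqrt_pos.2 (sub_pos.2 ht)).ne'
    refine ⟨_, V.smul_mem (y t)⁻¹ hmem.2, ?_⟩
    have hsum' := ((ContinuousLinearMap.snd ℝ E E).hasSum hsum).const_smul (y t)⁻¹
    simpa [smul_comm (y t)⁻¹, smul_smul, hne] using hsum'

theorem HasStemExpansion.coeff_mem_iff (h : HasStemExpansion D F z₀ a b) (him : 0 < z₀.im)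
    (hV : IsClosed (V : Set E)) :
    (∀ n, a n ∈ V ∧ b n ∈ V) ↔ ∀ᶠ z in 𝓝 z₀, F z ∈ V.prod V :=
  ⟨h.eventually_mem hV, h.coeff_mem him hV⟩

theorem HasStemExpansion.sub (hF : HasStemExpansion D F z₀ a b)
    (hG : HasStemExpansion D G z₀ a' b') : HasStemExpansion D (F - G) z₀ (a - a') (b - b') := by
  obtain ⟨R, hR, hF⟩ := hF
  obtain ⟨R', hR', hG⟩ := hG
  refine ⟨min R R', lt_min hR hR', fun z hz => ?_⟩
  have hle {r : ℝ} (h : min R R' ≤ r) : ‖complexCharPoly z₀ z‖ < r ^ 2 :=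
    hz.trans_le (pow_le_pow_left₀ (lt_min hR hR').le h 2)
  obtain ⟨hzD, hFz⟩ := hF z (hle (min_le_left _ _))
  obtain ⟨-, hGz⟩ := hG z (hle (min_le_right _ _))
  refine ⟨hzD, ?_⟩
  simpa only [Pi.sub_apply, map_sub, sub_apply, sub_add_sub_comm] using hFz.sub hGz

theorem HasStemExpansion.unique (h : HasStemExpansion D F z₀ a b)
    (h' : HasStemExpansion D F z₀ a' b') (him : 0 < z₀.im) : a = a' ∧ b = b' := by
  have hbot := (h.sub h').coeff_mem him (V := ⊥) isClosed_singleton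
    (.of_forall fun z => by simp [Submodule.prod_bot])
  exact ⟨funext fun n => sub_eq_zero.1 (hbot n).1, funext fun n => sub_eq_zero.1 (hbot n).2⟩

end StemExpansion

variable {D : Set ℂ} {F G : ℂ → ℍ[ℝ] × ℍ[ℝ]} {f : ℍ[ℝ] → ℍ[ℝ]}

/-- The evaluation `x + √-1 y ↦ x + I y` of `ℍ ⊗ ℂ` at an imaginary unit `I`. -/
noncomputable def evalUnit (I : imagUnits) : ℍ[ℝ] × ℍ[ℝ] →L[ℝ] ℍ[ℝ] :=
  .fst ℝ _ _ + (ContinuousLinearMap.mul ℝ ℍ[ℝ] I).comp (.snd ℝ _ _)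

theorem evalUnit_apply (I : imagUnits) (p : ℍ[ℝ] × ℍ[ℝ]) : evalUnit I p = p.1 + I * p.2 := rfl

theorem evalUnit_pureTensor (I : imagUnits) (q : ℍ[ℝ]) (w : ℂ) :
    evalUnit I (pureTensor q w) = sliceEmb I w * q := by
  rw [evalUnit_apply, pureTensor_apply, sliceEmb_apply, add_mul, mul_assoc,
    Quaternion.coe_mul_eq_smul, Quaternion.coe_mul_eq_smul]

theorem exists_leftInverse_evalUnit_pair :
    ∃ (I I' : imagUnits) (R : ℍ[ℝ] × ℍ[ℝ] →L[ℝ] ℍ[ℝ] × ℍ[ℝ]),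
      ∀ p, R (evalUnit I p, evalUnit I' p) = p := by
  obtain ⟨I⟩ : Nonempty imagUnits := inferInstance
  let mean : ℍ[ℝ] × ℍ[ℝ] →L[ℝ] ℍ[ℝ] :=
    (2⁻¹ : ℝ) • (ContinuousLinearMap.fst ℝ _ _ + ContinuousLinearMap.snd ℝ _ _)
  let halfDiff : ℍ[ℝ] × ℍ[ℝ] →L[ℝ] ℍ[ℝ] :=
    (2⁻¹ : ℝ) • (ContinuousLinearMap.fst ℝ _ _ - ContinuousLinearMap.snd ℝ _ _)
  refine ⟨I, ⟨-I, neg_mem_imagUnits I.2⟩,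
    mean.prod ((ContinuousLinearMap.mul ℝ ℍ[ℝ] (-I)).comp halfDiff), fun p => Prod.ext ?_ ?_⟩
  · change (2⁻¹ : ℝ) • (p.1 + I * p.2 + (p.1 + -I * p.2)) = p.1
    rw [neg_mul]
    module
  · change -(I : ℍ[ℝ]) * ((2⁻¹ : ℝ) • (p.1 + I * p.2 - (p.1 + -I * p.2))) = p.2
    have hhalf : (2⁻¹ : ℝ) • (p.1 + I * p.2 - (p.1 + -I * p.2)) = I * p.2 := by
      rw [neg_mul]
      module
    rw [hhalf, ← mul_assoc, neg_mul, imagUnits_mul_self, neg_neg, one_mul]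

theorem hasSum_iff_evalUnit {T : ℕ → ℍ[ℝ] × ℍ[ℝ]} {p : ℍ[ℝ] × ℍ[ℝ]} :
    HasSum T p ↔ ∀ I, HasSum (fun n => evalUnit I (T n)) (evalUnit I p) := by
  refine ⟨fun h I => (evalUnit I).hasSum h, fun h => ?_⟩
  obtain ⟨I, I', R, hR⟩ := exists_leftInverse_evalUnit_pair
  simpa only [hR] using R.hasSum ((h I).prodMk (h I'))

theorem eq_of_forall_evalUnit_eq {p q : ℍ[ℝ] × ℍ[ℝ]} (h : ∀ I, evalUnit I p = evalUnit I q) :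
    p = q := by
  obtain ⟨I, I', R, hR⟩ := exists_leftInverse_evalUnit_pair
  rw [← hR p, h I, h I', hR]

theorem Induces.apply_sliceEmb (hF : Induces D F f) {z : ℂ} (hz : z ∈ D) (I : imagUnits) :
    f (sliceEmb I z) = evalUnit I (F z) := by
  rw [sliceEmb_apply, evalUnit_apply]
  exact hF z.re z.im hz I I.2

theorem Induces.eqOn (hF : Induces D F f) (hG : Induces D G f) : Set.EqOn F G D := fun z hz =>
  eq_of_forall_evalUnit_eq fun I => by rw [← hF.apply_sliceEmb hz, ← hG.apply_sliceEmb hz]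

theorem sliceEmb_mem_cassiniBall {q₀ : ℍ[ℝ]} {R : ℝ} (I : imagUnits) (z : ℂ) :
    sliceEmb I z ∈ cassiniBall q₀ R ↔ ‖complexCharPoly (halfPlaneCoord q₀) z‖ < R ^ 2 := by
  rw [← norm_sliceEmb I, ← charPoly_sliceEmb]
  rfl

theorem exists_sliceEmb_eq (q : ℍ[ℝ]) : ∃ I z, sliceEmb I z = q :=
  (exists_sliceEmb_halfPlaneCoord q).imp fun _ hI => ⟨_, hI⟩

theorem evalUnit_stemExpansion_term (q₀ s₀ s₁ : ℍ[ℝ]) (I : imagUnits) (z : ℂ) (n : ℕ) :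
    evalUnit I (pureTensor (s₀ - q₀.im * s₁) (complexCharPoly (halfPlaneCoord q₀) z ^ n) +
      pureTensor s₁ (complexCharPoly (halfPlaneCoord q₀) z ^ n * (z - (halfPlaneCoord q₀).re))) =
      charPoly q₀ (sliceEmb I z) ^ n * (s₀ + (sliceEmb I z - q₀) * s₁) := by
  have hcentre : sliceEmb I (z - (halfPlaneCoord q₀).re) = sliceEmb I z - q₀ + q₀.im := by
    rw [map_sub, sliceEmb_ofReal, halfPlaneCoord, sub_add, Quaternion.sub_im_self]
  rw [map_add, evalUnit_pureTensor, evalUnit_pureTensor, map_mul, map_pow, ← charPoly_sliceEmb,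
    hcentre]
  noncomm_ring

theorem hasSphericalExpansion_iff_hasStemExpansion (hDs : ∀ z ∈ D, starRingEnd ℂ z ∈ D)
    (hF : Induces D F f) {q₀ : ℍ[ℝ]} {s : ℕ → ℍ[ℝ]} :
    HasSphericalExpansion D f q₀ s ↔ HasStemExpansion D F (halfPlaneCoord q₀)
      (fun n => s (2 * n) - q₀.im * s (2 * n + 1)) (fun n => s (2 * n + 1)) := by
  constructor
  · rintro ⟨R, hR, hsub, hsum⟩
    refine ⟨R, hR, fun z hz => ?_⟩
    have hmem (I : imagUnits) : sliceEmb I z ∈ cassiniBall q₀ R :=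
      (sliceEmb_mem_cassiniBall I z).2 hz
    have hzD : z ∈ D :=
      (sliceEmb_mem_circularization hDs (Classical.arbitrary _)).1 (hsub (hmem _))
    refine ⟨hzD, hasSum_iff_evalUnit.2 fun I => ?_⟩
    simpa only [evalUnit_stemExpansion_term, ← hF.apply_sliceEmb hzD] using hsum _ (hmem I)
  · rintro ⟨R, hR, hsum⟩
    have hball {x : ℍ[ℝ]} (hx : x ∈ cassiniBall q₀ R) :
        ∃ I z, sliceEmb I z = x ∧ ‖complexCharPoly (halfPlaneCoord q₀) z‖ < R ^ 2 := by
      obtain ⟨I, z, rfl⟩ := exists_sliceEmb_eq x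
      exact ⟨I, z, rfl, (sliceEmb_mem_cassiniBall I z).1 hx⟩
    refine ⟨R, hR, fun x hx => ?_, fun x hx => ?_⟩ <;> obtain ⟨I, z, rfl, hz⟩ := hball hx
    · exact (sliceEmb_mem_circularization hDs I).2 (hsum z hz).1
    · obtain ⟨hzD, hsum⟩ := hsum z hz
      simpa only [evalUnit_stemExpansion_term, ← hF.apply_sliceEmb hzD] using
        hasSum_iff_evalUnit.1 hsum I

theorem HasSphericalExpansion.unique (hDs : ∀ z ∈ D, starRingEnd ℂ z ∈ D) (hF : Induces D F f)
    {q₀ : ℍ[ℝ]} (hq₀ : q₀ ∉ realLine) {s s' : ℕ → ℍ[ℝ]} (hs : HasSphericalExpansion D f q₀ s)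
    (hs' : HasSphericalExpansion D f q₀ s') : s = s' := by
  rw [hasSphericalExpansion_iff_hasStemExpansion hDs hF] at hs hs'
  obtain ⟨heven, hodd⟩ := hs.unique hs' (halfPlaneCoord_im_pos hq₀)
  have hodd (k : ℕ) : s (2 * k + 1) = s' (2 * k + 1) := congrFun hodd k
  funext n
  rcases n.even_or_odd' with ⟨k, rfl | rfl⟩
  · simpa only [hodd, sub_left_inj] using congrFun heven k
  · exact hodd k

theorem IsHolomorphic.differentiableOn_complexComponent (hF : IsHolomorphic D F)
    (ℓ : ℍ[ℝ] →L[ℝ] ℝ) : DifferentiableOn ℂ (complexComponent ℓ ∘ F) D := by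
  intro z hz
  obtain ⟨L, hL, hLI⟩ := hF z hz
  have hcomp := (complexComponent ℓ).hasFDerivAt.comp z hL
  refine (differentiableAt_complex_iff_differentiableAt_real.2
    ⟨hcomp.differentiableAt, ?_⟩).differentiableWithinAt
  have hI := hLI 1
  rw [mul_one] at hI
  rw [hcomp.fderiv]
  simp [hI, mulSqrtNegOne, complexComponent_apply, Complex.ext_iff]

theorem IsStemFunction.complexComponent_conj (hF : IsStemFunction D F) (ℓ : ℍ[ℝ] →L[ℝ] ℝ) {z : ℂ}
    (hz : z ∈ D) :
    complexComponent ℓ (F (starRingEnd ℂ z)) = starRingEnd ℂ (complexComponent ℓ (F z)) := by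
  simp [hF z hz, complexComponent_apply, Complex.ext_iff]

theorem exists_real_coeff_hasSum_complexCharPoly {g : ℂ → ℂ} {z₀ : ℂ} {R : ℝ} (hR : 0 ≤ R)
    (hRim : R ≤ z₀.im) (hRD : ∀ z, ‖complexCharPoly z₀ z‖ < R ^ 2 → z ∈ D)
    (hg : DifferentiableOn ℂ g D)
    (hconj : ∀ z ∈ D, g (starRingEnd ℂ z) = starRingEnd ℂ (g z)) :
    ∃ a b : ℕ → ℝ, ∀ z, ‖complexCharPoly z₀ z‖ < R ^ 2 →
      HasSum (fun n => complexCharPoly z₀ z ^ n * (a n + (z - z₀.re) * b n)) (g z) := by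
  have hchar (v : ℂ) : complexCharPoly z₀ (z₀.re + v) = v ^ 2 + (z₀.im ^ 2 : ℝ) := by
    rw [complexCharPoly_eq_sq_add_sq, add_sub_cancel_left, Complex.ofReal_pow]
  have hmem (v : ℂ) (hv : ‖v ^ 2 + (z₀.im ^ 2 : ℝ)‖ < R ^ 2) : z₀.re + v ∈ D :=
    hRD _ (by rwa [hchar])
  have hle : R ^ 2 ≤ ‖z₀.im ^ 2‖ := (pow_le_pow_left₀ hR hRim 2).trans (le_abs_self _)
  obtain ⟨a, b, hab⟩ := exists_real_coeff_hasSum_even_odd (h := fun v => g (z₀.re + v)) hle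
    (hg.comp (by fun_prop) hmem) fun v hv => by
      simpa only [map_add, Complex.conj_ofReal] using hconj _ (hmem v hv)
  refine ⟨a, b, fun z hz => ?_⟩
  have hz' := hchar (z - z₀.re)
  rw [add_sub_cancel] at hz'
  simpa only [← hz', add_sub_cancel] using hab (z - z₀.re) (hz' ▸ hz)

theorem IsHolomorphic.exists_hasStemExpansion (hol : IsHolomorphic D F)
    (hst : IsStemFunction D F) (hDo : IsOpen D) (hDs : ∀ z ∈ D, starRingEnd ℂ z ∈ D) {z₀ : ℂ}
    (hz₀ : z₀ ∈ D) (him : 0 < z₀.im) : ∃ a b, HasStemExpansion D F z₀ a b := by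
  obtain ⟨R, hR, hRim, hRD⟩ := exists_complexCharPoly_ball_subset hDo hDs hz₀ him
  let β := Module.finBasis ℝ ℍ[ℝ]
  let ℓ (j) : ℍ[ℝ] →L[ℝ] ℝ := LinearMap.toContinuousLinearMap (β.coord j)
  choose a b hab using fun j => exists_real_coeff_hasSum_complexCharPoly hR.le hRim hRD
    (hol.differentiableOn_complexComponent (ℓ j)) fun z hz => hst.complexComponent_conj (ℓ j) hz
  refine ⟨fun n => ∑ j, a j n • β j, fun n => ∑ j, b j n • β j, R, hR, fun z hz =>
    ⟨hRD z hz, ?_⟩⟩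
  have hsum := hasSum_sum (s := Finset.univ) fun j _ => (pureTensor (β j)).hasSum (hab j z hz)
  simp only [ℓ, Function.comp_apply, sum_pureTensor_complexComponent] at hsum
  convert hsum using 2 with n
  have hreal (q : ℍ[ℝ]) (r : ℝ) (w : ℂ) : pureTensor (r • q) w = pureTensor q (w * r) := by
    rw [map_smul, smul_apply, ← map_smul, Complex.real_smul, mul_comm]
  simp only [map_sum, sum_apply, hreal, ← Finset.sum_add_distrib, ← map_add,
    mul_add, mul_assoc]

theorem exists_hasSphericalExpansion (hDo : IsOpen D) (hDs : ∀ z ∈ D, starRingEnd ℂ z ∈ D)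
    (hf : IsSliceRegular D f) {q₀ : ℍ[ℝ]} (hq₀ : q₀ ∈ circularization D \ realLine) :
    ∃ s, HasSphericalExpansion D f q₀ s := by
  obtain ⟨F, hst, hol, hind⟩ := hf
  obtain ⟨a, b, hab⟩ := hol.exists_hasStemExpansion hst hDo hDs
    ((mem_circularization_iff hDs).1 hq₀.1) (halfPlaneCoord_im_pos hq₀.2)
  refine ⟨fun n => if Even n then a (n / 2) + q₀.im * b (n / 2) else b (n / 2),
    (hasSphericalExpansion_iff_hasStemExpansion hDs hind).2 ?_⟩
  convert hab using 2 with n n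
  · simp [Nat.mul_add_div]
  · simp [Nat.mul_add_div]

theorem existsUnique_hasSphericalExpansion (hDo : IsOpen D) (hDs : ∀ z ∈ D, starRingEnd ℂ z ∈ D)
    (hf : IsSliceRegular D f) {q₀ : ℍ[ℝ]} (hq₀ : q₀ ∈ circularization D \ realLine) :
    ∃! s, HasSphericalExpansion D f q₀ s := by
  obtain ⟨s, hs⟩ := exists_hasSphericalExpansion hDo hDs hf hq₀
  obtain ⟨F, -, -, hind⟩ := hf
  exact ⟨s, hs, fun s' hs' => hs'.unique hDs hind hq₀.2 hs⟩

theorem hasSphericalExpansion_sphericalCoeff (hDo : IsOpen D)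
    (hDs : ∀ z ∈ D, starRingEnd ℂ z ∈ D) (hf : IsSliceRegular D f) {q₀ : ℍ[ℝ]}
    (hq₀ : q₀ ∈ circularization D \ realLine) :
    HasSphericalExpansion D f q₀ (sphericalCoeff D f q₀) := by
  have h := exists_hasSphericalExpansion hDo hDs hf hq₀
  rw [sphericalCoeff, dif_pos h]
  exact h.choose_spec

variable {V : Submodule ℝ ℍ[ℝ]}

theorem IsStemFunction.apply_conj_mem_prod_iff (hF : IsStemFunction D F) {z : ℂ} (hz : z ∈ D) :
    F (starRingEnd ℂ z) ∈ V.prod V ↔ F z ∈ V.prod V := by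
  rw [hF z hz]
  exact and_congr_right' V.neg_mem_iff

theorem IsStemFunction.apply_halfPlaneCoord_sliceEmb_mem_prod_iff (hF : IsStemFunction D F)
    {z : ℂ} (hz : z ∈ D) (I : imagUnits) :
    F (halfPlaneCoord (sliceEmb I z)) ∈ V.prod V ↔ F z ∈ V.prod V := by
  rcases halfPlaneCoord_sliceEmb_eq_or I z with h | h <;> rw [h]
  exact hF.apply_conj_mem_prod_iff hz

theorem IsHolomorphic.continuousOn (hF : IsHolomorphic D F) : ContinuousOn F D := fun z hz =>
  let ⟨_, hL, _⟩ := hF z hz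
  hL.continuousAt.continuousWithinAt

theorem IsHolomorphic.forall_mem_prod_of_eventually (hol : IsHolomorphic D F)
    (hst : IsStemFunction D F) (hDo : IsOpen D) (hDs : ∀ z ∈ D, starRingEnd ℂ z ∈ D)
    (hconn : IsPreconnected (circularization D)) {q₀ : ℍ[ℝ]} (hq₀ : q₀ ∈ circularization D)
    (h : ∀ᶠ z in 𝓝 (halfPlaneCoord q₀), F z ∈ V.prod V) :
    ∀ z ∈ D, F z ∈ V.prod V := by
  -- `D` itself need not be connected, but its part in the closed upper half-plane is.
  have hU : IsPreconnected (halfPlaneCoord '' circularization D) :=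
    hconn.image _ continuous_halfPlaneCoord.continuousOn
  have hUD : halfPlaneCoord '' circularization D ⊆ D :=
    Set.image_subset_iff.2 fun q hq => (mem_circularization_iff hDs).1 hq
  have hupper : ∀ q ∈ circularization D, F (halfPlaneCoord q) ∈ V.prod V := fun q hq =>
    mem_prod_iff_complexComponent.2 fun ℓ hℓ =>
      (((hol.differentiableOn_complexComponent ℓ).analyticOnNhd hDo).mono hUD
        ).eqOn_zero_of_preconnected_of_eventuallyEq_zero hU (Set.mem_image_of_mem _ hq₀)
        (h.mono fun z hz => mem_prod_iff_complexComponent.1 hz ℓ hℓ) (Set.mem_image_of_mem _ hq)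
  obtain ⟨I⟩ : Nonempty imagUnits := inferInstance
  exact fun z hz => (hst.apply_halfPlaneCoord_sliceEmb_mem_prod_iff hz I).1
    (hupper _ ((sliceEmb_mem_circularization hDs I).2 hz))

theorem IsHolomorphic.forall_mem_prod_of_im_ne_zero (hol : IsHolomorphic D F) (hDo : IsOpen D)
    (h : ∀ z ∈ D, z.im ≠ 0 → F z ∈ V.prod V) :
    ∀ z ∈ D, F z ∈ V.prod V := by
  have hdense : Dense {z : ℂ | z.im ≠ 0} :=
    (dense_compl_singleton (0 : ℝ)).preimage Complex.isOpenMap_im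
  have hclosed : IsClosed (V.prod V : Set (ℍ[ℝ] × ℍ[ℝ])) :=
    Submodule.closed_of_finiteDimensional _
  intro z hz
  exact hclosed.closure_subset (((hol.continuousOn z hz).mono Set.inter_subset_left).mem_closure
    (hdense.open_subset_closure_inter hDo hz) fun w hw => h w hw.1 hw.2)

/-- The slice `ℂ_J` as a real subspace of `ℍ`. -/
noncomputable def sliceSubmodule (J : imagUnits) : Submodule ℝ ℍ[ℝ] :=
  LinearMap.range (sliceEmb J).toLinearMap

theorem coe_sliceSubmodule (J : imagUnits) :
    (sliceSubmodule J : Set ℍ[ℝ]) = slicePlane J := by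
  ext q
  constructor
  · rintro ⟨z, rfl⟩
    refine ⟨z.re, z.im, ?_⟩
    rw [Quaternion.coe_mul_eq_smul, ← Quaternion.mul_coe_eq_smul]
    exact sliceEmb_apply J z
  · rintro ⟨α, β, rfl⟩
    refine ⟨⟨α, β⟩, ?_⟩
    rw [Quaternion.coe_mul_eq_smul, ← Quaternion.mul_coe_eq_smul]
    exact sliceEmb_apply J _

theorem sliceEmb_mem_sliceSubmodule (J : imagUnits) (z : ℂ) : sliceEmb J z ∈ sliceSubmodule J :=
  ⟨z, rfl⟩

theorem im_mul_mem_sliceSubmodule {J : imagUnits} {p q : ℍ[ℝ]} (hp : p ∈ sliceSubmodule J)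
    (hq : q ∈ sliceSubmodule J) : p.im * q ∈ sliceSubmodule J := by
  obtain ⟨z, rfl⟩ := hp
  obtain ⟨w, rfl⟩ := hq
  change (sliceEmb J z).im * sliceEmb J w ∈ _
  rw [im_sliceEmb, ← map_mul]
  exact sliceEmb_mem_sliceSubmodule J _

theorem sliceEmb_mem_realLine {I : imagUnits} {z : ℂ} : sliceEmb I z ∈ realLine ↔ z.im = 0 := by
  rw [mem_realLine_iff_im_eq_zero, im_sliceEmb, ← norm_eq_zero, norm_sliceEmb]
  simp

theorem mem_realLine_iff_forall_mem_slicePlane {q : ℍ[ℝ]} :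
    q ∈ realLine ↔ ∀ J ∈ imagUnits, q ∈ slicePlane J := by
  constructor
  · rintro ⟨r, rfl⟩ J -
    exact ⟨r, 0, by simp⟩
  · intro h
    obtain ⟨I, hI, hI₁⟩ : ∃ I ∈ imagUnits, I.imI = 1 :=
      ⟨⟨0, 1, 0, 0⟩, mem_imagUnits_of_re_eq_zero rfl (by simp), rfl⟩
    obtain ⟨J, hJ, hJ₁⟩ : ∃ J ∈ imagUnits, J.imI = 0 :=
      ⟨⟨0, 0, 1, 0⟩, mem_imagUnits_of_re_eq_zero rfl (by simp), rfl⟩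
    obtain ⟨a, b, hqI⟩ := h I hI
    obtain ⟨c, d, hqJ⟩ := h J hJ
    have hb : b = 0 := by simpa [hI₁, hJ₁] using congrArg QuaternionAlgebra.imI (hqI.symm.trans hqJ)
    exact ⟨a, by simp [hqI, hb]⟩

theorem isSlicePreserving_iff_forall_isOneSlicePreserving :
    IsSlicePreserving D f ↔ ∀ J ∈ imagUnits, IsOneSlicePreserving D J f := by
  simp only [IsSlicePreserving, mem_realLine_iff_forall_mem_slicePlane]
  constructor
  · rintro ⟨F, hst, hind, hF⟩ J hJ
    exact ⟨F, hst, hind, fun z hz => ⟨(hF z hz).1 J hJ, (hF z hz).2 J hJ⟩⟩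
  · intro h
    obtain ⟨I⟩ : Nonempty imagUnits := inferInstance
    obtain ⟨F, hst, hind, -⟩ := h I I.2
    have hF : ∀ z ∈ D, ∀ J ∈ imagUnits, (F z).1 ∈ slicePlane J ∧ (F z).2 ∈ slicePlane J := by
      intro z hz J hJ
      obtain ⟨G, -, hindG, hG⟩ := h J hJ
      rw [hind.eqOn hindG hz]
      exact hG z hz
    exact ⟨F, hst, hind, fun z hz => ⟨fun J hJ => (hF z hz J hJ).1, fun J hJ => (hF z hz J hJ).2⟩⟩

theorem isOneSlicePreserving_iff (hst : IsStemFunction D F) (hind : Induces D F f)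
    (J : imagUnits) : IsOneSlicePreserving D J f ↔
      ∀ z ∈ D, F z ∈ (sliceSubmodule J).prod (sliceSubmodule J) := by
  simp only [IsOneSlicePreserving, ← coe_sliceSubmodule]
  refine ⟨?_, fun h => ⟨F, hst, hind, h⟩⟩
  rintro ⟨G, -, hindG, hG⟩ z hz
  rw [hind.eqOn hindG hz]
  exact hG z hz

theorem HasSphericalExpansion.coeff_mem_iff (hDs : ∀ z ∈ D, starRingEnd ℂ z ∈ D)
    (hind : Induces D F f) {q₀ : ℍ[ℝ]} (hq₀ : q₀ ∉ realLine) {s : ℕ → ℍ[ℝ]}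
    (hs : HasSphericalExpansion D f q₀ s) :
    (∀ k, s (2 * k) - q₀.im * s (2 * k + 1) ∈ V ∧ s (2 * k + 1) ∈ V) ↔
      ∀ᶠ z in 𝓝 (halfPlaneCoord q₀), F z ∈ V.prod V :=
  ((hasSphericalExpansion_iff_hasStemExpansion hDs hind).1 hs).coeff_mem_iff
    (halfPlaneCoord_im_pos hq₀) V.closed_of_finiteDimensional

theorem HasSphericalExpansion.coeff_mem_sliceSubmodule_iff
    (hDs : ∀ z ∈ D, starRingEnd ℂ z ∈ D) (hind : Induces D F f) {q₀ : ℍ[ℝ]} (hq₀ : q₀ ∉ realLine)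
    {s : ℕ → ℍ[ℝ]} (hs : HasSphericalExpansion D f q₀ s) {J : imagUnits}
    (hq₀J : q₀ ∈ sliceSubmodule J) :
    (∀ k, s (2 * k) ∈ sliceSubmodule J ∧ s (2 * k + 1) ∈ sliceSubmodule J) ↔
      ∀ᶠ z in 𝓝 (halfPlaneCoord q₀), F z ∈ (sliceSubmodule J).prod (sliceSubmodule J) := by
  rw [← hs.coeff_mem_iff hDs hind hq₀]
  exact forall_congr' fun k => and_congr_left fun hodd =>
    (Submodule.sub_mem_iff_left _ (im_mul_mem_sliceSubmodule hq₀J hodd)).symm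

theorem isOneSlicePreserving_iff_sphericalCoeff (hDo : IsOpen D)
    (hDs : ∀ z ∈ D, starRingEnd ℂ z ∈ D) (hf : IsSliceRegular D f) {J : ℍ[ℝ]}
    (hJ : J ∈ imagUnits) :
    IsOneSlicePreserving D J f ↔ ∀ q₀ ∈ circularization D \ realLine, ∀ k : ℕ,
      sphericalCoeff D f q₀ (2 * k + 1) ∈ slicePlane J ∧
      (q₀ ∈ slicePlane J → sphericalCoeff D f q₀ (2 * k) ∈ slicePlane J) := by
  have hspec {q₀ : ℍ[ℝ]} (hq₀ : q₀ ∈ circularization D \ realLine) :=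
    hasSphericalExpansion_sphericalCoeff hDo hDs hf hq₀
  obtain ⟨F, hst, hol, hind⟩ := hf
  lift J to imagUnits using hJ
  rw [isOneSlicePreserving_iff hst hind]
  simp only [← coe_sliceSubmodule, SetLike.mem_coe]
  constructor
  · intro h q₀ hq₀ k
    have hnear : ∀ᶠ z in 𝓝 (halfPlaneCoord q₀), F z ∈ (sliceSubmodule J).prod (sliceSubmodule J) :=
      (hDo.eventually_mem ((mem_circularization_iff hDs).1 hq₀.1)).mono h
    exact ⟨(((hspec hq₀).coeff_mem_iff hDs hind hq₀.2).2 hnear k).2, fun hq₀J =>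
      (((hspec hq₀).coeff_mem_sliceSubmodule_iff hDs hind hq₀.2 hq₀J).2 hnear k).1⟩
  · intro h
    refine hol.forall_mem_prod_of_im_ne_zero hDo fun z hz him => ?_
    have hq₀J := sliceEmb_mem_sliceSubmodule J z
    have hq₀ : sliceEmb J z ∈ circularization D \ realLine :=
      ⟨(sliceEmb_mem_circularization hDs J).2 hz, mt sliceEmb_mem_realLine.1 him⟩
    have hnear := ((hspec hq₀).coeff_mem_sliceSubmodule_iff hDs hind hq₀.2 hq₀J).1 fun k =>
      ⟨(h _ hq₀ k).2 hq₀J, (h _ hq₀ k).1⟩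
    exact (hst.apply_halfPlaneCoord_sliceEmb_mem_prod_iff hz J).1 hnear.self_of_nhds

theorem isSlicePreserving_iff_sphericalCoeff (hDo : IsOpen D)
    (hDs : ∀ z ∈ D, starRingEnd ℂ z ∈ D) (hf : IsSliceRegular D f) :
    IsSlicePreserving D f ↔ ∀ q₀ ∈ circularization D \ realLine, ∀ k : ℕ,
      sphericalCoeff D f q₀ (2 * k + 1) ∈ realLine ∧
      ∀ I ∈ imagUnits, q₀ ∈ slicePlane I → sphericalCoeff D f q₀ (2 * k) ∈ slicePlane I := by
  have hone {J : ℍ[ℝ]} (hJ : J ∈ imagUnits) :=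
    isOneSlicePreserving_iff_sphericalCoeff hDo hDs hf hJ
  simp only [isSlicePreserving_iff_forall_isOneSlicePreserving,
    mem_realLine_iff_forall_mem_slicePlane]
  constructor
  · intro h q₀ hq₀ k
    have hcoeff (J) (hJ : J ∈ imagUnits) := (hone hJ).1 (h J hJ) q₀ hq₀ k
    exact ⟨fun J hJ => (hcoeff J hJ).1, fun J hJ => (hcoeff J hJ).2⟩
  · intro h J hJ
    exact (hone hJ).2 fun q₀ hq₀ k => ⟨(h q₀ hq₀ k).1 J hJ, (h q₀ hq₀ k).2 J hJ⟩

theorem isOneSlicePreserving_iff_sphericalCoeff_of_isPreconnected (hDo : IsOpen D)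
    (hDs : ∀ z ∈ D, starRingEnd ℂ z ∈ D) (hf : IsSliceRegular D f)
    (hconn : IsPreconnected (circularization D)) {J : ℍ[ℝ]} (hJ : J ∈ imagUnits) {q₀ : ℍ[ℝ]}
    (hq₀ : q₀ ∈ circularization D \ realLine) (hq₀J : q₀ ∈ slicePlane J) :
    IsOneSlicePreserving D J f ↔ ∀ n : ℕ, sphericalCoeff D f q₀ n ∈ slicePlane J := by
  constructor
  · intro h n
    have hcoeff := (isOneSlicePreserving_iff_sphericalCoeff hDo hDs hf hJ).1 h q₀ hq₀
    rcases n.even_or_odd' with ⟨k, rfl | rfl⟩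
    · exact (hcoeff k).2 hq₀J
    · exact (hcoeff k).1
  · intro h
    have hspec := hasSphericalExpansion_sphericalCoeff hDo hDs hf hq₀
    obtain ⟨F, hst, hol, hind⟩ := hf
    lift J to imagUnits using hJ
    rw [isOneSlicePreserving_iff hst hind]
    simp only [← coe_sliceSubmodule, SetLike.mem_coe] at h hq₀J
    exact hol.forall_mem_prod_of_eventually hst hDo hDs hconn hq₀.1 <|
      (hspec.coeff_mem_sliceSubmodule_iff hDs hind hq₀.2 hq₀J).1 fun k => ⟨h _, h _⟩

end SliceRegular

theorem corollary4p2 (D : Set ℂ) (hDo : IsOpen D) (hDs : ∀ z ∈ D, starRingEnd ℂ z ∈ D)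
    (f : ℍ[ℝ] → ℍ[ℝ]) (hf : IsSliceRegular D f) :
    -- the spherical coefficients exist and are unique
    (∀ q₀ ∈ circularization D \ realLine, ∃! s : ℕ → ℍ[ℝ], HasSphericalExpansion D f q₀ s) ∧
    -- slice preserving functions
    (IsSlicePreserving D f ↔
      ∀ q₀ ∈ circularization D \ realLine, ∀ k : ℕ,
        sphericalCoeff D f q₀ (2 * k + 1) ∈ realLine ∧
        ∀ I ∈ imagUnits, q₀ ∈ slicePlane I → sphericalCoeff D f q₀ (2 * k) ∈ slicePlane I) ∧
    -- one-slice preserving functions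
    (∀ J ∈ imagUnits,
      (IsOneSlicePreserving D J f ↔
        ∀ q₀ ∈ circularization D \ realLine, ∀ k : ℕ,
          sphericalCoeff D f q₀ (2 * k + 1) ∈ slicePlane J ∧
          (q₀ ∈ slicePlane J → sphericalCoeff D f q₀ (2 * k) ∈ slicePlane J))) ∧
    -- one-slice preserving functions, tested at a single point of the slice
    (IsConnected (circularization D) → ∀ J ∈ imagUnits,
      ∀ q₀ ∈ circularization D \ realLine, q₀ ∈ slicePlane J →
        (IsOneSlicePreserving D J f ↔ ∀ n : ℕ, sphericalCoeff D f q₀ n ∈ slicePlane J)) := by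
  exact ⟨fun q₀ hq₀ => existsUnique_hasSphericalExpansion hDo hDs hf hq₀,
    isSlicePreserving_iff_sphericalCoeff hDo hDs hf,
    fun J hJ => isOneSlicePreserving_iff_sphericalCoeff hDo hDs hf hJ,
    fun hconn J hJ q₀ hq₀ hq₀J =>
      isOneSlicePreserving_iff_sphericalCoeff_of_isPreconnected hDo hDs hf
        hconn.isPreconnected hJ hq₀ hq₀J⟩
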